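/- Let $(X,\mathcal F,\nu)$ be a probability space such that $L^2(\nu)$ is separable, let $d$ be a dimension, and let $\mu=\nu^{\mathbb Z^d}$ be the product measure on $\Omega=X^{\mathbb Z^d}$. All functions are real valued, elements of $L^2(\mu)$ are identified when they agree $\mu$-almost everywhere, and $\langle f\rangle=\int f\,d\mu$. Let $\mathcal D\subset L^2(\mu)$ be the space of local functions, i.e. of those $f\in L^2(\mu)$ that are given by a measurable function depending on only finitely many coordinates. For $z\in\mathbb Z^d$ put $(\tau_z\eta)_x=\eta_{x-z}$ and $(\tau_zf)(\eta)=f(\tau_z\eta)$, and for $f,g\in\mathcal D$ put $$\langle f\,|\,g\rangle=\sum_{x\in\mathbb Z^d}\bigl(\langle \tau_xf\; g\rangle-\langle f\rangle\langle g\rangle\bigr).$$ Let $\mathfrak G=\bigl\{\sum_{\alpha=1}^d(\tau_{e_\alpha}g_\alpha-g_\alpha) : g_1,\dots,g_d\in\mathcal D\bigr\}$, where $e_\alpha$ is the $\alpha$-th unit vector of $\mathbb Z^d$. Then the series defining $\langle f\,|\,g\rangle$ converges absolutely for all $f,g\in\mathcal D$, and if $f\in\mathcal D$ satisfies $\langle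 f\rangle=0$ and $\langle f\,|\,f\rangle=0$, then $f\in\mathfrak G$. Equivalently, the kernel of $\langle\cdot\,|\,\cdot\rangle$ in $\mathcal D$, which is both $\{f\in\mathcal D:\langle f\,|\,f\rangle=0\}$ and $\{f\in\mathcal D:\langle f\,|\,g\rangle=0\text{ for all }g\in\mathcal D\}$, is the direct sum of the space of constant functions and $\mathfrak G$. -/

import Mathlib

open MeasureTheory

noncomputable section

namespace GradientSpace

/-- The lattice `ℤ^d`. -/
abbrev Lattice (d : ℕ) : Type := Fin d → ℤ

/-- The configuration space `Ω = X^{ℤ^d}`, with the product σ-algebra. -/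
abbrev Config (X : Type*) (d : ℕ) : Type _ := Lattice d → X

/-- The shift of configurations, `(τ_z η)_x = η_{x - z}`. -/
def shift {X : Type*} {d : ℕ} (z : Lattice d) (η : Config X d) : Config X d :=
  fun x => η (x - z)

section

variable {X : Type*} [MeasurableSpace X] (ν : Measure X) [IsProbabilityMeasure ν] (d : ℕ)

/-- The product measure `μ = ν^{ℤ^d}`. -/
abbrev prodMeasure : Measure (Config X d) := Measure.infinitePi (fun _ : Lattice d => ν)

/-- The real Hilbert space `L²(μ)`. Its elements are functions modulo `μ`-null sets. -/
abbrev L2 : Type _ := Lp ℝ 2 (prodMeasure ν d)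

variable {d}

theorem measurePreserving_shift (z : Lattice d) :
    MeasurePreserving (shift z) (prodMeasure ν d) (prodMeasure ν d) := by
  refine ⟨by unfold shift; fun_prop, ?_⟩
  have h := Measure.infinitePi_map_piCongrLeft (fun _ : Lattice d => ν) (Equiv.addRight z)
  have e : (shift z : Config X d → Config X d)
      = MeasurableEquiv.piCongrLeft (fun _ => X) (Equiv.addRight z) := by
    funext η x
    have := MeasurableEquiv.piCongrLeft_apply_apply (Equiv.addRight z)
      (β := fun _ => X) η (x - z)
    simpa [shift] using this.symm
  rw [e]
  exact h

/-- The shift of functions, `(τ_z f)(η) = f(τ_z η)`, on `L²(μ)`. -/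
def translate (z : Lattice d) : L2 ν d →ₗ[ℝ] L2 ν d :=
  Lp.compMeasurePreservingₗ ℝ (shift z) (measurePreserving_shift ν z)

variable (d) in
/-- `𝒟`: the (classes of) functions in `L²(μ)` that are local, i.e. that are given by a measurable
function depending only on finitely many coordinates. -/
def localFunctions : Submodule ℝ (L2 ν d) where
  carrier := {f | ∃ (s : Finset (Lattice d)) (F : Config X d → ℝ),
    Measurable F ∧ DependsOn F (s : Set (Lattice d)) ∧ f =ᵐ[prodMeasure ν d] F}
  zero_mem' := ⟨∅, fun _ => 0, measurable_const, fun _ _ _ => rfl, Lp.coeFn_zero ℝ 2 _⟩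
  add_mem' := by
    classical
    rintro f g ⟨s, F, hF, hFs, hf⟩ ⟨t, G, hG, hGt, hg⟩
    refine ⟨s ∪ t, F + G, hF.add hG, fun x y h => ?_, (Lp.coeFn_add f g).trans (hf.add hg)⟩
    have h1 : F x = F y := hFs fun i hi => h i (by simp [Finset.mem_coe.1 hi])
    have h2 : G x = G y := hGt fun i hi => h i (by simp [Finset.mem_coe.1 hi])
    simp [h1, h2]
  smul_mem' := by
    rintro c f ⟨s, F, hF, hFs, hf⟩
    refine ⟨s, c • F, hF.const_smul c, fun x y h => ?_,
      (Lp.coeFn_smul c f).trans (hf.const_smul c)⟩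
    simp [hFs h]

/-- The expectation `⟨f⟩`. -/
def mean (f : L2 ν d) : ℝ := ∫ η, f η ∂(prodMeasure ν d)

/-- `⟨τ_x f g⟩ - ⟨f⟩⟨g⟩`, the covariance of `τ_x f` and `g`. -/
def shiftCov (f g : L2 ν d) (x : Lattice d) : ℝ :=
  (∫ η, translate ν x f η * g η ∂(prodMeasure ν d)) - mean ν f * mean ν g

/-- `⟨f | g⟩ = ∑_{x ∈ ℤ^d} (⟨τ_x f g⟩ - ⟨f⟩⟨g⟩)`. -/
def bracket (f g : L2 ν d) : ℝ := ∑' x : Lattice d, shiftCov ν f g x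

variable (d) in
/-- The gradient space `𝔊 = {∑_α (τ^α g_α - g_α) : g_α ∈ 𝒟}` with `τ^α = τ_{e_α}`. -/
def gradientSpace : Submodule ℝ (L2 ν d) where
  carrier := {f | ∃ g : Fin d → L2 ν d, (∀ α, g α ∈ localFunctions ν d) ∧
    f = ∑ α, (translate ν (Pi.single α 1) (g α) - g α)}
  zero_mem' := ⟨0, fun _ => Submodule.zero_mem _, by simp⟩
  add_mem' := by
    rintro _ _ ⟨g, hg, rfl⟩ ⟨h, hh, rfl⟩
    refine ⟨g + h, fun α => Submodule.add_mem _ (hg α) (hh α), ?_⟩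
    rw [← Finset.sum_add_distrib]
    refine Finset.sum_congr rfl fun α _ => ?_
    rw [Pi.add_apply, map_add]
    abel
  smul_mem' := by
    rintro c _ ⟨g, hg, rfl⟩
    refine ⟨c • g, fun α => Submodule.smul_mem _ c (hg α), ?_⟩
    rw [Finset.smul_sum]
    refine Finset.sum_congr rfl fun α _ => ?_
    rw [Pi.smul_apply, map_smul, smul_sub]

variable (d) in
/-- The space of constant functions. -/
def constants : Submodule ℝ (L2 ν d) :=
  LinearMap.range (Lp.constₗ 2 (prodMeasure ν d) ℝ : ℝ →ₗ[ℝ] L2 ν d)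

end

end GradientSpace

end

open GradientSpace

open MeasureTheory

noncomputable section

namespace GradientSpace

set_option linter.unusedSectionVars false

variable {X : Type*} [MeasurableSpace X] (ν : Measure X) [IsProbabilityMeasure ν] {d : ℕ}

/-! The bracket is unchanged when an argument is shifted, so it vanishes on gradients and depends on
a local function only modulo $\mathfrak G$. It therefore suffices to find, in the class of a
mean-zero local $f$, a representative $g$ with $\langle g\,|\,g\rangle=\|g\|^2$: then $\langle
f\,|\,f\rangle=0$ forces $g=0$, that is, $f\in\mathfrak G$.

Order $\mathbb Z^d$ lexicographically and integrate out the sites of $f$ one at a time, largest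
first (`exists_orthogonal_erase`). This writes $f$ as a sum of martingale differences; shifting each
one so that its top site is the origin changes it by a gradient (`translate_sub_mem_gradientSpace`),
and $g$ is the sum of the shifted terms (`exists_martingaleDifference`). It depends on sites $\le 0$
and is orthogonal to functions of sites $<0$. The order is translation invariant, so $g$ is
orthogonal to its nontrivial shifts and only $x=0$ contributes to $\langle g\,|\,g\rangle$
(`bracket_self_of_mem_martingaleDifferences`). -/

/-- The functions in `L²(μ)` given by a measurable function of the coordinates in `s`. -/
def localOn (s : Set (Lattice d)) : Submodule ℝ (L2 ν d) where
  carrier := {f | ∃ F : Config X d → ℝ,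
    Measurable F ∧ DependsOn F s ∧ f =ᵐ[prodMeasure ν d] F}
  zero_mem' := ⟨fun _ => 0, measurable_const, fun _ _ _ => rfl, Lp.coeFn_zero ℝ 2 _⟩
  add_mem' := by
    rintro f g ⟨F, hF, hFs, hf⟩ ⟨G, hG, hGs, hg⟩
    refine ⟨F + G, hF.add hG, fun x y h => ?_, (Lp.coeFn_add f g).trans (hf.add hg)⟩
    simp [hFs h, hGs h]
  smul_mem' := by
    rintro c f ⟨F, hF, hFs, hf⟩
    refine ⟨c • F, hF.const_smul c, fun x y h => ?_,
      (Lp.coeFn_smul c f).trans (hf.const_smul c)⟩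
    simp [hFs h]

variable {ν}

theorem mem_localFunctions {f : L2 ν d} :
    f ∈ localFunctions ν d ↔ ∃ s : Finset (Lattice d), f ∈ localOn ν (s : Set (Lattice d)) :=
  Iff.rfl

theorem localOn_mono {s t : Set (Lattice d)} (h : s ⊆ t) : localOn ν s ≤ localOn ν t := by
  rintro f ⟨F, hF, hFs, hf⟩
  exact ⟨F, hF, fun x y hxy => hFs fun i hi => hxy i (h hi), hf⟩

theorem localOn_le_localFunctions {s : Set (Lattice d)} (hs : s.Finite) :
    localOn ν s ≤ localFunctions ν d := fun f hf =>
  mem_localFunctions.2 ⟨hs.toFinset, by simpa using hf⟩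

/-! ### Translations -/

theorem coeFn_translate (z : Lattice d) (f : L2 ν d) :
    translate ν z f =ᵐ[prodMeasure ν d] f ∘ shift z :=
  Lp.coeFn_compMeasurePreserving f (measurePreserving_shift ν z)

theorem shift_shift {Y : Type*} (z w : Lattice d) (η : Config Y d) :
    shift z (shift w η) = shift (z + w) η := by
  funext x
  simp [shift, sub_sub]

theorem translate_zero (f : L2 ν d) : translate ν 0 f = f := by
  refine Lp.ext ((coeFn_translate 0 f).trans (Filter.Eventually.of_forall fun η => ?_))
  simp only [Function.comp_apply]
  congr 1
  funext x
  simp [shift]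

theorem translate_translate (z w : Lattice d) (f : L2 ν d) :
    translate ν z (translate ν w f) = translate ν (z + w) f := by
  refine Lp.ext ?_
  filter_upwards [coeFn_translate z (translate ν w f), coeFn_translate (z + w) f,
    (measurePreserving_shift ν z).quasiMeasurePreserving.ae (coeFn_translate w f)] with η h1 h2 h3
  rw [h1, h2, Function.comp_apply, h3, Function.comp_apply, Function.comp_apply, shift_shift,
    add_comm]

theorem inner_translate_translate (z : Lattice d) (f g : L2 ν d) :
    inner ℝ (translate ν z f) (translate ν z g) = inner ℝ f g :=
  (Lp.compMeasurePreservingₗᵢ ℝ (shift z) (measurePreserving_shift ν z)).inner_map_map f g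

theorem inner_translate_left (z : Lattice d) (f g : L2 ν d) :
    inner ℝ (translate ν z f) g = inner ℝ f (translate ν (-z) g) := by
  rw [← inner_translate_translate (-z), translate_translate, neg_add_cancel, translate_zero]

theorem translate_mem_localOn (z : Lattice d) {s : Set (Lattice d)} {f : L2 ν d}
    (hf : f ∈ localOn ν s) : translate ν z f ∈ localOn ν {x | x + z ∈ s} := by
  obtain ⟨F, hF, hFs, hf⟩ := hf
  refine ⟨F ∘ shift z, hF.comp (measurePreserving_shift ν z).measurable, fun x y h => ?_, ?_⟩
  · refine hFs fun i hi => h (i - z) ?_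
    simpa using hi
  · exact (coeFn_translate z f).trans
      ((measurePreserving_shift ν z).quasiMeasurePreserving.ae_eq_comp hf)

theorem translate_mem_localFunctions (z : Lattice d) {f : L2 ν d}
    (hf : f ∈ localFunctions ν d) : translate ν z f ∈ localFunctions ν d := by
  obtain ⟨s, hs⟩ := mem_localFunctions.1 hf
  refine localOn_le_localFunctions ?_ (translate_mem_localOn z hs)
  exact s.finite_toSet.preimage (add_left_injective z).injOn

/-! ### Constants and means -/

variable (ν) in
/-- The constant function `c` in `L²(μ)`. -/
def constL2 (c : ℝ) : L2 ν d := Lp.constₗ 2 (prodMeasure ν d) ℝ c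

theorem coeFn_constL2 (c : ℝ) : constL2 ν c =ᵐ[prodMeasure ν d] fun _ => c :=
  Lp.coeFn_const ..

theorem constL2_mem_localOn (c : ℝ) (s : Set (Lattice d)) : constL2 ν c ∈ localOn ν s :=
  ⟨fun _ => c, measurable_const, fun _ _ _ => rfl, coeFn_constL2 c⟩

theorem inner_eq_integral (f g : L2 ν d) :
    inner ℝ f g = ∫ η, f η * g η ∂(prodMeasure ν d) := by
  rw [L2.inner_def]
  refine integral_congr_ae (Filter.Eventually.of_forall fun η => ?_)
  simp [mul_comm]

theorem inner_constL2 (f : L2 ν d) (c : ℝ) : inner ℝ f (constL2 ν c) = c * mean ν f := by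
  rw [inner_eq_integral, mean, ← integral_const_mul]
  refine integral_congr_ae ?_
  filter_upwards [coeFn_constL2 (ν := ν) (d := d) c] with η h
  rw [h, mul_comm]

theorem mean_eq_inner (f : L2 ν d) : mean ν f = inner ℝ f (constL2 ν 1) := by
  rw [inner_constL2, one_mul]

theorem mean_constL2 (c : ℝ) : mean ν (constL2 ν c : L2 ν d) = c := by
  rw [mean, integral_congr_ae (coeFn_constL2 c)]
  simp

theorem mean_add (f g : L2 ν d) : mean ν (f + g) = mean ν f + mean ν g := by
  simp only [mean_eq_inner, inner_add_left]

theorem mean_sub (f g : L2 ν d) : mean ν (f - g) = mean ν f - mean ν g := by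
  simp only [mean_eq_inner, inner_sub_left]

theorem translate_constL2 (z : Lattice d) (c : ℝ) :
    translate ν z (constL2 ν c) = constL2 ν c := by
  refine Lp.ext ?_
  filter_upwards [coeFn_translate z (constL2 ν c : L2 ν d), coeFn_constL2 (ν := ν) (d := d) c,
    (measurePreserving_shift ν z).quasiMeasurePreserving.ae (coeFn_constL2 c)] with η h1 h2 h3
  rw [h1, h2, Function.comp_apply, h3]

theorem mean_translate (z : Lattice d) (f : L2 ν d) : mean ν (translate ν z f) = mean ν f := by
  rw [mean_eq_inner, inner_translate_left, translate_constL2, mean_eq_inner]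

theorem mean_of_mem_gradientSpace {f : L2 ν d} (hf : f ∈ gradientSpace ν d) : mean ν f = 0 := by
  obtain ⟨g, -, rfl⟩ := hf
  rw [mean_eq_inner, sum_inner]
  exact Finset.sum_eq_zero fun α _ => by
    rw [← mean_eq_inner, mean_sub, mean_translate, sub_self]

theorem eq_constL2_of_mem_localOn_empty {f : L2 ν d} (hf : f ∈ localOn ν (∅ : Set (Lattice d))) :
    f = constL2 ν (mean ν f) := by
  obtain ⟨F, -, hFs, hf⟩ := hf
  obtain ⟨c, hc⟩ : ∃ c, ∀ η, F η = c := by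
    rcases isEmpty_or_nonempty (Config X d) with h | ⟨⟨η⟩⟩
    · exact ⟨0, fun η => h.elim η⟩
    · exact ⟨F η, fun η' => hFs fun i hi => hi.elim⟩
  have hfc : f = constL2 ν c := by
    refine Lp.ext ?_
    filter_upwards [hf, coeFn_constL2 (ν := ν) (d := d) c] with η h1 h2
    rw [h1, h2, hc]
  rw [hfc, mean_constL2]

/-! ### Integrating out one coordinate -/

/-- Resampling one coordinate independently preserves a product measure. On boxes, the fresh sample
supplies the factor at `a` and the old configuration supplies the others. -/
theorem measurePreserving_update (a : Lattice d) :
    MeasurePreserving (fun p : Config X d × X => Function.update p.1 a p.2)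
      ((prodMeasure ν d).prod ν) (prodMeasure ν d) := by
  have hm : Measurable (fun p : Config X d × X => Function.update p.1 a p.2) :=
    measurable_update'
  refine ⟨hm, Measure.eq_infinitePi _ fun s t ht => ?_⟩
  rw [Measure.map_apply hm (MeasurableSet.pi s.countable_toSet fun i _ => ht i)]
  by_cases ha : a ∈ s
  · have : (fun p : Config X d × X => Function.update p.1 a p.2) ⁻¹' (Set.pi s t) =
        (Set.pi (s.erase a : Finset (Lattice d)) t) ×ˢ (t a) := by
      ext p
      simp only [Set.mem_preimage, Set.mem_pi, Set.mem_prod, Finset.mem_coe, Finset.mem_erase]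
      constructor
      · intro h
        refine ⟨fun i hi => ?_, by simpa using h a ha⟩
        simpa [Function.update_of_ne hi.1] using h i hi.2
      · rintro ⟨h1, h2⟩ i hi
        rcases eq_or_ne i a with rfl | hia
        · simpa using h2
        · simpa [Function.update_of_ne hia] using h1 i ⟨hia, hi⟩
    rw [this, Measure.prod_prod, Measure.infinitePi_pi _ (fun i _ => ht i),
      Finset.prod_erase_mul _ _ ha]
  · have : (fun p : Config X d × X => Function.update p.1 a p.2) ⁻¹' (Set.pi s t) =
        (Set.pi s t) ×ˢ Set.univ := by
      ext p
      simp only [Set.mem_preimage, Set.mem_pi, Set.mem_prod, Set.mem_univ, and_true]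
      refine forall₂_congr fun i hi => ?_
      rw [Function.update_of_ne (by rintro rfl; exact ha hi)]
    rw [this, Measure.prod_prod, Measure.infinitePi_pi _ (fun i _ => ht i), measure_univ, mul_one]

theorem sq_integral_le_integral_sq {Y : Type*} [MeasurableSpace Y] {ρ : Measure Y}
    [IsProbabilityMeasure ρ] {F : Y → ℝ} (hF : MemLp F 2 ρ) :
    (∫ y, F y ∂ρ) ^ 2 ≤ ∫ y, F y ^ 2 ∂ρ := by
  have h := ProbabilityTheory.variance_nonneg F ρ
  rw [ProbabilityTheory.variance_eq_sub hF] at h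
  simpa using h

theorem memLp_two_integral_prod_right {Y Z : Type*} [MeasurableSpace Y] [MeasurableSpace Z]
    {ρ : Measure Y} [SFinite ρ] {σ : Measure Z} [IsProbabilityMeasure σ] {F : Y × Z → ℝ}
    (hF : MemLp F 2 (ρ.prod σ)) : MemLp (fun y => ∫ z, F (y, z) ∂σ) 2 ρ := by
  have hm := hF.aestronglyMeasurable.integral_prod_right'
  have hi := (memLp_two_iff_integrable_sq hF.aestronglyMeasurable).1 hF
  rw [memLp_two_iff_integrable_sq hm]
  refine hi.integral_prod_left.mono' (hm.pow 2) ?_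
  filter_upwards [hi.prod_right_ae, hF.aestronglyMeasurable.prodMk_left] with y h1 h2
  rw [Real.norm_of_nonneg (sq_nonneg _)]
  exact sq_integral_le_integral_sq ((memLp_two_iff_integrable_sq h2).2 h1)

/-- Here `p` is the conditional expectation of `f` given the coordinates other than `a`, built as an
explicit integral over that coordinate so that it visibly depends only on `s \ {a}`. Orthogonality
is Fubini after resampling, since `h` does not see `a`. -/
theorem exists_orthogonal_erase (a : Lattice d) {s : Set (Lattice d)} {f : L2 ν d}
    (hf : f ∈ localOn ν s) :
    ∃ p ∈ localOn ν (s \ {a}), ∀ h ∈ localOn ν ({a}ᶜ : Set (Lattice d)),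
      inner ℝ (f - p) h = 0 := by
  obtain ⟨F, hF, hFs, hf⟩ := hf
  have hup := measurePreserving_update (ν := ν) a
  have hF2 : MemLp F 2 (prodMeasure ν d) := (memLp_congr_ae hf).1 (Lp.memLp f)
  have hFu : MemLp (fun p : Config X d × X => F (Function.update p.1 a p.2)) 2
      ((prodMeasure ν d).prod ν) := hF2.comp_measurePreserving hup
  have hP := memLp_two_integral_prod_right hFu
  refine ⟨hP.toLp _, ⟨_, ?_, fun x y hxy => ?_, hP.coeFn_toLp⟩, ?_⟩
  · exact ((hF.comp hup.measurable).stronglyMeasurable.integral_prod_right').measurable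
  · refine integral_congr_ae (Filter.Eventually.of_forall fun b => hFs fun i hi => ?_)
    rcases eq_or_ne i a with rfl | hia
    · simp
    · simpa [Function.update_of_ne hia] using hxy i ⟨hi, hia⟩
  · intro h hh
    have hint : Integrable (fun η => F η * h η) (prodMeasure ν d) :=
      hF2.integrable_mul (Lp.memLp h)
    obtain ⟨H, hH, hHs, hhH⟩ := hh
    have hFH : Integrable (fun η => F η * H η) (prodMeasure ν d) :=
      hint.congr (by filter_upwards [hhH] with η e; rw [e])
    have hHup : ∀ η b, H (Function.update η a b) = H η := fun η b =>
      hHs fun i hi => Function.update_of_ne hi _ _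
    rw [inner_sub_left, sub_eq_zero, inner_eq_integral, inner_eq_integral]
    calc ∫ η, f η * h η ∂(prodMeasure ν d) = ∫ η, F η * H η ∂(prodMeasure ν d) :=
          integral_congr_ae (by filter_upwards [hf, hhH] with η e1 e2; rw [e1, e2])
      _ = ∫ p, F (Function.update p.1 a p.2) * H (Function.update p.1 a p.2)
            ∂((prodMeasure ν d).prod ν) := by
          have hmeas : AEStronglyMeasurable (fun η => F η * H η)
              (((prodMeasure ν d).prod ν).map fun p => Function.update p.1 a p.2) := by
            rw [hup.map_eq]
            exact hFH.aestronglyMeasurable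
          have := integral_map hup.measurable.aemeasurable hmeas
          rwa [hup.map_eq] at this
      _ = ∫ η, ∫ b, F (Function.update η a b) * H (Function.update η a b) ∂ν
            ∂(prodMeasure ν d) := integral_prod _ (hup.integrable_comp_of_integrable hFH)
      _ = ∫ η, hP.toLp _ η * h η ∂(prodMeasure ν d) := by
          refine integral_congr_ae ?_
          filter_upwards [hP.coeFn_toLp, hhH] with η e1 e2
          rw [e1, e2, ← integral_mul_const]
          simp only [hHup]

/-- Independence over disjoint sets of sites. Integrating out a site of `f` changes neither its
inner product with `g` nor its mean, and finitely many such steps leave a constant. -/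
theorem inner_eq_mean_mul_mean (s : Finset (Lattice d)) {t : Set (Lattice d)}
    (hst : Disjoint (s : Set (Lattice d)) t) {f g : L2 ν d}
    (hf : f ∈ localOn ν (s : Set (Lattice d))) (hg : g ∈ localOn ν t) :
    inner ℝ f g = mean ν f * mean ν g := by
  induction s using Finset.induction_on generalizing f with
  | empty =>
    rw [Finset.coe_empty] at hf
    rw [eq_constL2_of_mem_localOn_empty hf, real_inner_comm, inner_constL2, mean_constL2]
  | insert a s ha ih =>
    rw [Finset.coe_insert, Set.disjoint_insert_left] at hst
    obtain ⟨p, hp, hperp⟩ := exists_orthogonal_erase a hf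
    have hg' : g ∈ localOn ν ({a}ᶜ : Set (Lattice d)) :=
      localOn_mono (by rintro x hx rfl; exact hst.1 hx) hg
    have h1 := hperp g hg'
    have h2 := hperp _ (constL2_mem_localOn 1 _)
    rw [inner_sub_left, sub_eq_zero] at h1 h2
    rw [← mean_eq_inner, ← mean_eq_inner] at h2
    rw [h1, h2]
    refine ih hst.2 (localOn_mono ?_ hp)
    rintro x ⟨hx, hxa⟩
    simpa [show x ≠ a from hxa] using hx

/-! ### The bracket -/

theorem shiftCov_eq (f g : L2 ν d) (x : Lattice d) :
    shiftCov ν f g x = inner ℝ (translate ν x f) g - mean ν f * mean ν g := by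
  rw [shiftCov, inner_eq_integral]

theorem summable_shiftCov {f g : L2 ν d} (hf : f ∈ localFunctions ν d)
    (hg : g ∈ localFunctions ν d) : Summable (shiftCov ν f g) := by
  classical
  obtain ⟨s, hs⟩ := mem_localFunctions.1 hf
  obtain ⟨t, ht⟩ := mem_localFunctions.1 hg
  -- The shift by `x` of `f` lives on `s - x`, which meets `t` only when `x` is in `s - t`.
  refine summable_of_ne_finset_zero
    (s := (s ×ˢ t).image fun p => p.1 - p.2) fun x hx => ?_
  have hdisj : Disjoint (t : Set (Lattice d)) {y | y + x ∈ (s : Set (Lattice d))} := by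
    refine Set.disjoint_left.2 fun y hy hys => hx ?_
    exact Finset.mem_image.2 ⟨(y + x, y), Finset.mem_product.2 ⟨hys, hy⟩, by simp⟩
  rw [shiftCov_eq, real_inner_comm,
    inner_eq_mean_mul_mean t hdisj ht (translate_mem_localOn x hs), mean_translate, mul_comm,
    sub_self]

theorem bracket_comm (f g : L2 ν d) : bracket ν f g = bracket ν g f := by
  unfold bracket
  rw [← (Equiv.neg (Lattice d)).tsum_eq]
  refine tsum_congr fun x => ?_
  rw [shiftCov_eq, shiftCov_eq, Equiv.neg_apply, inner_translate_left, neg_neg, real_inner_comm,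
    mul_comm]

theorem bracket_add_left {f g h : L2 ν d} (hf : f ∈ localFunctions ν d)
    (hg : g ∈ localFunctions ν d) (hh : h ∈ localFunctions ν d) :
    bracket ν (f + g) h = bracket ν f h + bracket ν g h := by
  unfold bracket
  rw [← (summable_shiftCov hf hh).tsum_add (summable_shiftCov hg hh)]
  refine tsum_congr fun x => ?_
  simp only [shiftCov_eq, map_add, inner_add_left, mean_add]
  ring

theorem bracket_translate_left (z : Lattice d) (f g : L2 ν d) :
    bracket ν (translate ν z f) g = bracket ν f g := by
  unfold bracket
  rw [← (Equiv.addRight z).tsum_eq (shiftCov ν f g)]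
  refine tsum_congr fun x => ?_
  simp only [shiftCov_eq, translate_translate, mean_translate, Equiv.coe_addRight]

theorem bracket_constL2_left (c : ℝ) (g : L2 ν d) : bracket ν (constL2 ν c) g = 0 := by
  unfold bracket
  refine (tsum_congr fun x => ?_).trans tsum_zero
  rw [shiftCov_eq, translate_constL2, real_inner_comm, inner_constL2, mean_constL2, sub_self]

theorem gradientSpace_le_localFunctions : gradientSpace ν d ≤ localFunctions ν d := by
  rintro _ ⟨g, hg, rfl⟩
  exact Submodule.sum_mem _ fun α _ =>
    Submodule.sub_mem _ (translate_mem_localFunctions _ (hg α)) (hg α)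

theorem bracket_of_mem_gradientSpace {f g : L2 ν d} (hf : f ∈ gradientSpace ν d)
    (hg : g ∈ localFunctions ν d) : bracket ν f g = 0 := by
  obtain ⟨u, hu, rfl⟩ := hf
  have hmem : ∀ α, translate ν (Pi.single α 1) (u α) - u α ∈ localFunctions ν d := fun α =>
    Submodule.sub_mem _ (translate_mem_localFunctions _ (hu α)) (hu α)
  have hz : bracket ν 0 g = 0 := by
    have := bracket_add_left (Submodule.zero_mem _) (Submodule.zero_mem _) hg
    simpa using this
  -- Additivity of the bracket is available only for local functions, so locality is carried through
  -- the induction.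
  refine (Finset.sum_induction _ (fun v => v ∈ localFunctions ν d ∧ bracket ν v g = 0)
    ?_ ⟨Submodule.zero_mem _, hz⟩ fun α _ => ⟨hmem α, ?_⟩).2
  · rintro v w ⟨hv, hv0⟩ ⟨hw, hw0⟩
    exact ⟨Submodule.add_mem _ hv hw, by rw [bracket_add_left hv hw hg, hv0, hw0, add_zero]⟩
  · have h := bracket_add_left (hmem α) (hu α) hg
    rw [sub_add_cancel, bracket_translate_left] at h
    linarith

/-- By telescoping, the `z` that work for all local functions form a subgroup; it contains the unit
vectors. -/
theorem translate_sub_mem_gradientSpace (z : Lattice d) {f : L2 ν d}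
    (hf : f ∈ localFunctions ν d) : translate ν z f - f ∈ gradientSpace ν d := by
  let S : AddSubgroup (Lattice d) :=
    { carrier := {z | ∀ f ∈ localFunctions ν d, translate ν z f - f ∈ gradientSpace ν d}
      zero_mem' := fun f _ => by simp [translate_zero]
      add_mem' := fun {z w} hz hw f hf => by
        have := Submodule.add_mem _ (hz _ (translate_mem_localFunctions w hf)) (hw f hf)
        rwa [translate_translate, sub_add_sub_cancel] at this
      neg_mem' := fun {z} hz f hf => by
        have := Submodule.neg_mem _ (hz _ (translate_mem_localFunctions (-z) hf))
        rwa [translate_translate, add_neg_cancel, translate_zero, neg_sub] at this }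
  have hbasis : ∀ α : Fin d, Pi.single α (1 : ℤ) ∈ S := fun α f hf => by
    refine ⟨Pi.single α f, fun β => ?_, ?_⟩
    · rcases eq_or_ne β α with rfl | h
      · simpa using hf
      · simp [h]
    · rw [Finset.sum_eq_single α (fun β _ h => by simp [h]) (by simp)]
      simp
  have hz : z ∈ S := by
    rw [pi_eq_sum_univ' z]
    exact S.sum_mem fun α _ => S.zsmul_mem (hbasis α) _
  exact hz f hf

/-! ### Reduction modulo gradients -/

theorem toLex_add_lt_iff (x y z : Lattice d) :
    toLex (x + z) < toLex (y + z) ↔ toLex x < toLex y := by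
  rw [toLex_add, toLex_add, add_lt_add_iff_right]

variable (ν d) in
/-- The local functions of the coordinates up to `0`, in the lexicographic order, that are
orthogonal to all functions of the coordinates before `0`. -/
def martingaleDifferences : Submodule ℝ (L2 ν d) where
  carrier := {g | g ∈ localFunctions ν d ∧ g ∈ localOn ν {x | toLex x ≤ toLex 0} ∧
    ∀ h ∈ localOn ν {x : Lattice d | toLex x < toLex 0}, inner ℝ g h = 0}
  zero_mem' := ⟨Submodule.zero_mem _, Submodule.zero_mem _, by simp⟩
  add_mem' := by
    rintro f g ⟨hf1, hf2, hf3⟩ ⟨hg1, hg2, hg3⟩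
    exact ⟨Submodule.add_mem _ hf1 hg1, Submodule.add_mem _ hf2 hg2, fun h hh => by
      rw [inner_add_left, hf3 h hh, hg3 h hh, add_zero]⟩
  smul_mem' := by
    rintro c f ⟨hf1, hf2, hf3⟩
    exact ⟨Submodule.smul_mem _ c hf1, Submodule.smul_mem _ c hf2, fun h hh => by
      rw [inner_smul_left, hf3 h hh, mul_zero]⟩

theorem exists_martingaleDifference (s : Finset (Lattice d)) {f : L2 ν d}
    (hf : f ∈ localOn ν (s : Set (Lattice d))) (hf0 : mean ν f = 0) :
    ∃ g ∈ martingaleDifferences ν d, f - g ∈ gradientSpace ν d := by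
  classical
  induction s using Finset.induction_on_max_value (fun x : Lattice d => toLex x)
    generalizing f with
  | empty =>
    rw [Finset.coe_empty] at hf
    refine ⟨0, Submodule.zero_mem _, ?_⟩
    rw [eq_constL2_of_mem_localOn_empty hf, hf0, sub_zero]
    simp [constL2]
  | insert a s ha hmax ih =>
    obtain ⟨p, hp, hperp⟩ := exists_orthogonal_erase a hf
    have hps : p ∈ localOn ν (s : Set (Lattice d)) := by
      refine localOn_mono ?_ hp
      rintro x ⟨hx, hxa⟩
      simpa [show x ≠ a from hxa] using hx
    have hp0 : mean ν p = 0 := by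
      have := hperp _ (constL2_mem_localOn 1 _)
      rw [← mean_eq_inner, mean_sub, hf0] at this
      linarith
    obtain ⟨g, hg, hpg⟩ := ih hps hp0
    have hp' : p ∈ localOn ν ((insert a s : Finset (Lattice d)) : Set (Lattice d)) :=
      localOn_mono Set.sdiff_subset hp
    have hD : f - p ∈ localOn ν ((insert a s : Finset (Lattice d)) : Set (Lattice d)) :=
      Submodule.sub_mem _ hf hp'
    have hDloc : f - p ∈ localFunctions ν d := mem_localFunctions.2 ⟨_, hD⟩
    -- The difference `f - p` is orthogonal to functions not seeing the largest site `a`; the shift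
    -- by `a` carries that site to the origin.
    refine ⟨translate ν a (f - p) + g, Submodule.add_mem _
      ⟨translate_mem_localFunctions a hDloc, ?_, fun h hh => ?_⟩ hg, ?_⟩
    · refine localOn_mono (fun x hx => ?_) (translate_mem_localOn a hD)
      have hxa : toLex (x + a) ≤ toLex (0 + a) := by
        rw [zero_add]
        rcases Finset.mem_insert.1 (Finset.mem_coe.1 hx) with h | h
        · rw [h]
        · exact hmax _ h
      exact not_lt.1 fun h => not_lt.2 hxa ((toLex_add_lt_iff _ _ a).2 h)
    · rw [inner_translate_left]
      -- Moved back by `-a`, `h` depends only on sites strictly before `a`.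
      refine hperp _ (localOn_mono (fun x hx => ?_) (translate_mem_localOn (-a) hh))
      rintro rfl
      have hx0 : toLex (x + -x) < toLex (0 : Lattice d) := hx
      rw [add_neg_cancel] at hx0
      exact lt_irrefl _ hx0
    · have := Submodule.sub_mem _ hpg (translate_sub_mem_gradientSpace a hDloc)
      convert this using 1
      abel

/-- For `x > 0` the shift of `g` by `x` depends on sites `≤ -x < 0`, hence is orthogonal to `g`;
negative `x` follow by moving the shift to the other factor. -/
theorem bracket_self_of_mem_martingaleDifferences {g : L2 ν d}
    (hg : g ∈ martingaleDifferences ν d) : bracket ν g g = ‖g‖ ^ 2 := by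
  obtain ⟨-, hg1, hg2⟩ := hg
  have hmean : mean ν g = 0 := by
    rw [mean_eq_inner]
    exact hg2 _ (constL2_mem_localOn 1 _)
  have hpos : ∀ x : Lattice d, toLex 0 < toLex x → inner ℝ g (translate ν x g) = 0 := by
    intro x hx
    refine hg2 _ (localOn_mono (fun y hy => ?_) (translate_mem_localOn x hg1))
    have hy' : toLex (y + x) ≤ toLex (0 : Lattice d) := hy
    have := hy'.trans_lt hx
    refine (toLex_add_lt_iff y 0 x).1 ?_
    rw [zero_add]
    exact this
  have hzero : ∀ x : Lattice d, x ≠ 0 → shiftCov ν g g x = 0 := by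
    intro x hx
    rw [shiftCov_eq, hmean, mul_zero, sub_zero]
    rcases lt_trichotomy (toLex x) (toLex 0) with h | h | h
    · rw [inner_translate_left]
      refine hpos _ ((toLex_add_lt_iff 0 (-x) x).1 ?_)
      rw [zero_add, neg_add_cancel]
      exact h
    · exact absurd (toLex.injective h) hx
    · rw [real_inner_comm]
      exact hpos x h
  rw [bracket, tsum_eq_single 0 hzero, shiftCov_eq, hmean, mul_zero, sub_zero, translate_zero,
    real_inner_self_eq_norm_sq]

/-! ### The kernel of the bracket -/

theorem mem_gradientSpace_of_bracket_self_eq_zero {f : L2 ν d} (hf : f ∈ localFunctions ν d)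
    (hf0 : mean ν f = 0) (hff : bracket ν f f = 0) : f ∈ gradientSpace ν d := by
  obtain ⟨s, hs⟩ := mem_localFunctions.1 hf
  obtain ⟨g, hg, hfg⟩ := exists_martingaleDifference s hs hf0
  have hleft : ∀ h ∈ localFunctions ν d, bracket ν f h = bracket ν g h := fun h hh => by
    have := bracket_add_left (gradientSpace_le_localFunctions hfg) hg.1 hh
    rwa [sub_add_cancel, bracket_of_mem_gradientSpace hfg hh, zero_add] at this
  -- Symmetry lets `f` replace `g` in both arguments.
  have hgg : bracket ν g g = 0 := by
    rw [← hleft g hg.1, bracket_comm, ← hleft f hf, hff]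
  rw [bracket_self_of_mem_martingaleDifferences hg, sq_eq_zero_iff, norm_eq_zero] at hgg
  rwa [hgg, sub_zero] at hfg

theorem mem_constants_iff {f : L2 ν d} : f ∈ constants ν d ↔ ∃ c, constL2 ν c = f :=
  Iff.rfl

theorem constants_le_localFunctions : constants ν d ≤ localFunctions ν d := by
  rintro _ ⟨c, rfl⟩
  exact localOn_le_localFunctions Set.finite_empty (constL2_mem_localOn c ∅)

/-- The mean separates the two spaces: it vanishes on gradients and recovers a constant. -/
theorem disjoint_constants_gradientSpace : Disjoint (constants ν d) (gradientSpace ν d) := by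
  rw [Submodule.disjoint_def]
  intro f hc hg
  obtain ⟨c, rfl⟩ := mem_constants_iff.1 hc
  have := mean_of_mem_gradientSpace hg
  rw [mean_constL2] at this
  simp [this, constL2]

theorem bracket_eq_zero_of_mem_sup {f g : L2 ν d} (hf : f ∈ constants ν d ⊔ gradientSpace ν d)
    (hg : g ∈ localFunctions ν d) : bracket ν f g = 0 := by
  obtain ⟨u, hu, v, hv, rfl⟩ := Submodule.mem_sup.1 hf
  rw [bracket_add_left (constants_le_localFunctions hu) (gradientSpace_le_localFunctions hv) hg,
    bracket_of_mem_gradientSpace hv hg, add_zero]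
  obtain ⟨c, rfl⟩ := mem_constants_iff.1 hu
  exact bracket_constL2_left c g

theorem mem_sup_of_bracket_self_eq_zero {f : L2 ν d} (hf : f ∈ localFunctions ν d)
    (hff : bracket ν f f = 0) : f ∈ constants ν d ⊔ gradientSpace ν d := by
  have hc : constL2 ν (mean ν f) ∈ constants ν d := mem_constants_iff.2 ⟨_, rfl⟩
  have hloc := Submodule.sub_mem _ hf (constants_le_localFunctions hc)
  have hleft : ∀ h ∈ localFunctions ν d,
      bracket ν f h = bracket ν (f - constL2 ν (mean ν f)) h := fun h hh => by
    have := bracket_add_left hloc (constants_le_localFunctions hc) hh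
    rwa [sub_add_cancel, bracket_constL2_left, add_zero] at this
  refine Submodule.mem_sup.2 ⟨_, hc, f - constL2 ν (mean ν f), ?_, by abel⟩
  refine mem_gradientSpace_of_bracket_self_eq_zero hloc ?_ ?_
  · rw [mean_sub, mean_constL2, sub_self]
  · rw [← hleft _ hloc, bracket_comm, ← hleft f hf, hff]

end GradientSpace

end

theorem theorem2p1 {X : Type*} [MeasurableSpace X] (ν : MeasureTheory.Measure X)
    [MeasureTheory.IsProbabilityMeasure ν]
    [TopologicalSpace.SeparableSpace (MeasureTheory.Lp ℝ 2 ν)] (d : ℕ) :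
    -- the series defining `⟨f | g⟩` converges for all `f, g ∈ 𝒟`
    (∀ f ∈ localFunctions ν d, ∀ g ∈ localFunctions ν d, Summable (shiftCov ν f g)) ∧
    -- `f ∈ 𝒟`, `⟨f⟩ = 0` and `⟨f | f⟩ = 0` imply `f ∈ 𝔊`
    (∀ f ∈ localFunctions ν d, mean ν f = 0 → bracket ν f f = 0 → f ∈ gradientSpace ν d) ∧
    -- the kernel of `⟨· | ·⟩` in `𝒟` is the direct sum of the constants and `𝔊`
    Disjoint (constants ν d) (gradientSpace ν d) ∧
    {f : L2 ν d | f ∈ localFunctions ν d ∧ bracket ν f f = 0} =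
      ((constants ν d ⊔ gradientSpace ν d : Submodule ℝ (L2 ν d)) : Set (L2 ν d)) ∧
    {f : L2 ν d | f ∈ localFunctions ν d ∧ ∀ g ∈ localFunctions ν d, bracket ν f g = 0} =
      ((constants ν d ⊔ gradientSpace ν d : Submodule ℝ (L2 ν d)) : Set (L2 ν d)) := by
  have hle : constants ν d ⊔ gradientSpace ν d ≤ localFunctions ν d :=
    sup_le constants_le_localFunctions gradientSpace_le_localFunctions
  refine ⟨fun f hf g hg => summable_shiftCov hf hg,
    fun f hf hf0 hff => mem_gradientSpace_of_bracket_self_eq_zero hf hf0 hff,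
    disjoint_constants_gradientSpace, ?_, ?_⟩
  · ext f
    exact ⟨fun h => mem_sup_of_bracket_self_eq_zero h.1 h.2,
      fun h => ⟨hle h, bracket_eq_zero_of_mem_sup h (hle h)⟩⟩
  · ext f
    exact ⟨fun h => mem_sup_of_bracket_self_eq_zero h.1 (h.2 f h.1),
      fun h => ⟨hle h, fun g hg => bracket_eq_zero_of_mem_sup h hg⟩⟩
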